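/- Let $G=(V,E)$ be a finite directed graph, and for $j\in V$ let $P_j=\{i : (i,j)\in E\}$. Consider functions $f:2^V\to\mathbb R$ with $f(\emptyset)=0$, with $f(\{j\})\le 1$ and $f(\{j\}\cup P_j)=f(P_j)$ for every $j\in V$. Put $I_f(A;B|C)=f(A\cup C)+f(B\cup C)-f(A\cup B\cup C)-f(C)$ and $I_f(A;B)=I_f(A;B|\emptyset)$. Let $E_S(G)$ be the maximum of $f(V)$ over those $f$ that satisfy Shannon's inequality $f(Z)+f(X\cup Y\cup Z)\le f(X\cup Z)+f(Y\cup Z)$ for all $X,Y,Z\subseteq V$, and let $E_{ZY}(G)$ be the maximum of $f(V)$ over those $f$ that satisfy the Zhang--Yeung inequality $2I_f(C;D)\le I_f(A;B)+I_f(A;C\cup D)+3I_f(C;D|A)+I_f(C;D|B)$ for all $A,B,C,D\subseteq V$. For $s\ge 2$ let $E(G,s)$ be the supremum of $H_p(V)$ over all probability distributions $p$ on $A^V$, $|A|=s$, whose base-$s$ entropy function $H_p$ satisfies $H_p(\{j\}\cup P_j)=H_p(P_j)$ for all $j$; and let $E(G)=\sup_{s\ge 2}E(G,s)$. Theorem.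 There is a finite directed graph $G$ with $E_{ZY}(G)<E_S(G)$ and $E(G)<E_S(G)$; that is, Shannon's inequalities alone do not determine the general entropy of $G$. Explicitly, $G$ can be taken as follows. Start from the Vámos matroid on $\{a,b,c,d,w,x,y,z\}$ (rank $4$) in which, with $P_1=\{a,w\}$, $P_2=\{b,x\}$, $P_3=\{c,y\}$, $P_4=\{d,z\}$, the four-element circuits are $P_1\cup P_2$, $P_1\cup P_3$, $P_1\cup P_4$, $P_2\cup P_3$, $P_2\cup P_4$. Let $N$ be the acyclic multiple-unicast network with unit-capacity edges and the seven messages $a_1,a_2,b,c_1,c_2,d_1,d_2$, each available at its own source node, in which bottleneck edges carry $a$ (computed from $a_1,a_2$), $c$ (from $c_1,c_2$), $d$ (from $d_1,d_2$), $w$ (from $a,b,c,d$), $x$ (from $a,b,w$), $y$ (from $a,c,w$), $z$ (from $a,d,w$), and in which seven receivers demand $d_1$ from $a,b,c,w,d_2$; $c_1$ from $a,b,d,w,c_2$; $a_1$ from $b,w,x,a_2$; $a_2$ from $c,d,y,z,a_1$; $b$ from $c,d,y,z$; $c_2$ from $b,x,y,c_1$; $d_2$ from $b,x,z,d_1$.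 Pass to the line graph of $N$ (vertices: one input and one output per message, and the edges of $N$; arcs from each input to the edges leaving its source, from each edge to the edges following it, and from each edge entering a receiver to the output demanded there), and identify the input of each message with its output. The resulting graph, with $64$ vertices, is $G$. -/

import Mathlib

/-! ### Entropy-like functions and the entropy parameters of a directed graph -/

namespace GraphEntropy

section Parameters

variable {V : Type*}

/-- Conditional value `f(X | Y) = f(X ∪ Y) - f(Y)`. -/
def cond (f : Set V → ℝ) (X Y : Set V) : ℝ := f (X ∪ Y) - f Y

/-- Mutual information `I_f(A ; B | C)`. -/
def mutualInfo (f : Set V → ℝ) (A B C : Set V) : ℝ :=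
  f (A ∪ C) + f (B ∪ C) - f (A ∪ B ∪ C) - f C

/-- Shannon entropy-like functions. -/
structure IsShannon (f : Set V → ℝ) : Prop where
  empty : f ∅ = 0
  shannon : ∀ X Y Z : Set V, f Z + f (X ∪ Y ∪ Z) ≤ f (X ∪ Z) + f (Y ∪ Z)

/-- Zhang-Yeung entropy-like functions. They are automatically Shannon: put
`(A, B, C, D) = (Z, ∅, X ∪ Z, Y ∪ Z)`. -/
structure IsZhangYeung (f : Set V → ℝ) : Prop where
  empty : f ∅ = 0
  zhangYeung : ∀ A B C D : Set V,
    2 * mutualInfo f C D ∅ ≤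
      mutualInfo f A B ∅ + mutualInfo f A (C ∪ D) ∅
        + 3 * mutualInfo f C D A + mutualInfo f C D B

/-- The set of predecessors of the vertex `j`. -/
def preds (G : Digraph V) (j : V) : Set V := {i | G.Adj i j}

/-- The information constraints of `G`: every vertex is determined by its predecessors. -/
def SatisfiesConstraints (G : Digraph V) (f : Set V → ℝ) : Prop :=
  ∀ j : V, cond f {j} (preds G j) = 0

/-- Normalisation: a single vertex carries at most one unit of entropy. -/
def IsNormalized (f : Set V → ℝ) : Prop := ∀ j : V, f {j} ≤ 1

/-- The S-entropy `E_S(G)`: the maximal value of `f(V)` over all normalised Shannon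
entropy-like functions that satisfy the information constraints of `G`. -/
noncomputable def shannonEntropy (G : Digraph V) : ℝ :=
  sSup {r | ∃ f : Set V → ℝ, IsShannon f ∧ IsNormalized f ∧ SatisfiesConstraints G f ∧
    r = f Set.univ}

/-- The ZY-entropy `E_ZY(G)`. -/
noncomputable def zhangYeungEntropy (G : Digraph V) : ℝ :=
  sSup {r | ∃ f : Set V → ℝ, IsZhangYeung f ∧ IsNormalized f ∧ SatisfiesConstraints G f ∧
    r = f Set.univ}

open Classical in
/-- Probability, under the distribution `p` on `A^V` with `A = Fin s`, that the coordinates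
in `S` are given by `u`. -/
noncomputable def marginal [Fintype V] {s : ℕ} (p : (V → Fin s) → ℝ) (S : Set V)
    (u : S → Fin s) : ℝ :=
  ∑ x : V → Fin s, if (∀ i : S, x i = u i) then p x else 0

open Classical in
/-- The entropy function `H_p` of a distribution `p` on `A^V`, `A = Fin s`, in base `s`:
`H_p(S) = ∑ u, p_S(u) log_s (1 / p_S(u))`, the sum being over all `u : A^S`. -/
noncomputable def entropyFun [Fintype V] {s : ℕ} (p : (V → Fin s) → ℝ) (S : Set V) : ℝ :=
  ∑ u : S → Fin s, marginal p S u * Real.logb s (1 / marginal p S u)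

open Classical in
/-- The entropy `E(G, s)` of `G` over an alphabet of size `s`. -/
noncomputable def entropyOver [Fintype V] (G : Digraph V) (s : ℕ) : ℝ :=
  sSup {r | ∃ p : (V → Fin s) → ℝ, (∀ x, 0 ≤ p x) ∧ ∑ x, p x = 1 ∧
    SatisfiesConstraints G (entropyFun p) ∧ r = entropyFun p Set.univ}

/-- The general entropy `E(G)`, the supremum of `E(G, s)` over `s = 2, 3, 4, …`. -/
noncomputable def generalEntropy [Fintype V] (G : Digraph V) : ℝ :=
  sSup {r | ∃ s : ℕ, 2 ≤ s ∧ r = entropyOver G s}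

end Parameters

/-! ### Multiple-unicast networks, their line graphs and the graph `G_N` -/

/-- A multiple-unicast network with nodes `V` and messages `M`: an acyclic directed graph in
which every message is generated at its own source node and is demanded at exactly one node,
its own sink.  Every edge carries one symbol. -/
structure UnicastNetwork (V M : Type*) where
  graph : Digraph V
  source : M → V
  sink : M → V
  acyclic : ∀ v, ¬ Relation.TransGen graph.Adj v v
  source_injective : Function.Injective source
  sink_injective : Function.Injective sink
  source_no_in : ∀ m v, ¬ graph.Adj v (source m)
  sink_no_out : ∀ m v, ¬ graph.Adj (sink m) v

namespace UnicastNetwork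

variable {V M : Type*} (N : UnicastNetwork V M)

/-- The edges of the network. -/
def Edge : Type _ := {e : V × V // N.graph.Adj e.1 e.2}

/-- The vertices of the circuit that is obtained by passing to the line graph: the input nodes
(one per message), the edges of the network, and the output nodes (one per message). -/
inductive CircuitVertex : Type _
  | input (m : M)
  | edge (e : N.Edge)
  | output (m : M)

/-- The line graph of the network, as a circuit with input and output nodes: each input feeds
the edges that leave its source, each edge feeds the edges that follow it, and each output is
fed by the edges that enter its sink. -/
inductive CircuitAdj : N.CircuitVertex → N.CircuitVertex → Prop
  | input_edge (m : M) (e : N.Edge) (h : N.source m = e.1.1) :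
      CircuitAdj (.input m) (.edge e)
  | edge_edge (e e' : N.Edge) (h : e.1.2 = e'.1.1) : CircuitAdj (.edge e) (.edge e')
  | edge_output (e : N.Edge) (m : M) (h : e.1.2 = N.sink m) :
      CircuitAdj (.edge e) (.output m)
  | input_output (m m' : M) (h : N.source m = N.sink m') :
      CircuitAdj (.input m) (.output m')

/-- The circuit, as a directed graph. -/
def lineCircuit : Digraph N.CircuitVertex := ⟨N.CircuitAdj⟩

/-- The vertices of `G_N`: the messages (input node = output node) and the edges. -/
abbrev GVertex : Type _ := M ⊕ N.Edge

/-- The map that identifies the input node of each message with its output node. -/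
def identify : N.CircuitVertex → N.GVertex
  | .input m => Sum.inl m
  | .edge e => Sum.inr e
  | .output m => Sum.inl m

/-- The graph `G_N`: the line graph of `N` with every input node identified with the
corresponding output node. -/
def identifiedGraph : Digraph N.GVertex :=
  ⟨fun u v => ∃ u' v', N.lineCircuit.Adj u' v' ∧ N.identify u' = u ∧ N.identify v' = v⟩

instance [Finite V] : Finite N.Edge :=
  inferInstanceAs (Finite {e : V × V // N.graph.Adj e.1 e.2})

noncomputable instance [Finite V] [Finite M] : Fintype N.GVertex := Fintype.ofFinite _

end UnicastNetwork

/-! ### The multiple-unicast Vámos network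

The Vámos matroid has rank `4` and the ground set `{a, b, c, d, w, x, y, z}`.  With the four
pairs `P₁ = {a, w}`, `P₂ = {b, x}`, `P₃ = {c, y}`, `P₄ = {d, z}`, its circuits of size `4` are
the five sets `P₁P₂`, `P₁P₃`, `P₁P₄`, `P₂P₃`, `P₂P₄`, but not `P₃P₄`.

In the Vámos network, the messages are `a, b, c, d`, the bottleneck edges are `w, x, y, z`, with
`w` computed from `a b c d`, `x` from `a b w`, `y` from `a c w`, `z` from `a d w`, and seven
receivers have to compute
`d` from `a b c w`, `c` from `a b d w`, `a` from `b w x`, `a` from `c d y z`, `b` from `c d y z`,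
`c` from `b x y`, `d` from `b x z`.

In the multiple-unicast version, the message `b` is demanded once and is kept.  Each
`m ∈ {a, c, d}`, which is demanded twice, becomes an edge that is computed from two new messages
`m₁, m₂`; the receivers that demanded `m` now demand one of `m₁, m₂` each, and are given the
other one. -/

/-- The seven messages. -/
inductive VamosMsg
  | a1 | a2 | b | c1 | c2 | d1 | d2
  deriving DecidableEq

instance : Fintype VamosMsg :=
  ⟨{.a1, .a2, .b, .c1, .c2, .d1, .d2}, by intro m; cases m <;> decide⟩

/-- The nodes: `sm` is the source of the message `m`; the symbols `a`, `c`, `d` are carried by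
`ja → ka`, `jc → kc`, `jd → kd`; the symbols `w`, `x`, `y`, `z` are carried by `n1 → n2`,
`n3 → n4`, `n5 → n6`, `n7 → n8`; the receivers are `n9, …, n15`. -/
inductive VamosNode
  | sa1 | sa2 | sb | sc1 | sc2 | sd1 | sd2
  | ja | ka | jc | kc | jd | kd
  | n1 | n2 | n3 | n4 | n5 | n6 | n7 | n8
  | n9 | n10 | n11 | n12 | n13 | n14 | n15
  deriving DecidableEq

instance : Fintype VamosNode :=
  ⟨{.sa1, .sa2, .sb, .sc1, .sc2, .sd1, .sd2, .ja, .ka, .jc, .kc, .jd, .kd,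
    .n1, .n2, .n3, .n4, .n5, .n6, .n7, .n8, .n9, .n10, .n11, .n12, .n13, .n14, .n15}, by
    intro v; cases v <;> decide⟩

open VamosNode in
/-- The edges, listed by their heads. -/
def vamosEdges : List (VamosNode × VamosNode) :=
  [ (sa1, ja), (sa2, ja), (ja, ka),
    (sc1, jc), (sc2, jc), (jc, kc),
    (sd1, jd), (sd2, jd), (jd, kd),
    (ka, n1), (sb, n1), (kc, n1), (kd, n1), (n1, n2),
    (ka, n3), (sb, n3), (n2, n3), (n3, n4),
    (ka, n5), (kc, n5), (n2, n5), (n5, n6),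
    (ka, n7), (kd, n7), (n2, n7), (n7, n8),
    (ka, n9), (sb, n9), (kc, n9), (n2, n9), (sd2, n9),
    (ka, n10), (sb, n10), (kd, n10), (n2, n10), (sc2, n10),
    (sb, n11), (n2, n11), (n4, n11), (sa2, n11),
    (kc, n12), (kd, n12), (n6, n12), (n8, n12), (sa1, n12),
    (kc, n13), (kd, n13), (n6, n13), (n8, n13),
    (sb, n14), (n4, n14), (n6, n14), (sc1, n14),
    (sb, n15), (n4, n15), (n8, n15), (sd1, n15) ]

/-- The source of each message. -/
def vamosSource : VamosMsg → VamosNode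
  | .a1 => .sa1 | .a2 => .sa2 | .b => .sb | .c1 => .sc1 | .c2 => .sc2 | .d1 => .sd1 | .d2 => .sd2

/-- The receiver that demands each message. -/
def vamosSink : VamosMsg → VamosNode
  | .d1 => .n9 | .c1 => .n10 | .a1 => .n11 | .a2 => .n12 | .b => .n13 | .c2 => .n14 | .d2 => .n15

set_option maxRecDepth 20000 in
/-- The edges go from smaller to larger numbers in the order in which the nodes are declared. -/
theorem vamosEdges_ctorIdx : ∀ e ∈ vamosEdges, e.1.ctorIdx < e.2.ctorIdx := by decide

theorem vamosEdges_acyclic {u v : VamosNode}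
    (h : Relation.TransGen (fun u v => (u, v) ∈ vamosEdges) u v) : u.ctorIdx < v.ctorIdx := by
  induction h with
  | single h => exact vamosEdges_ctorIdx _ h
  | tail _ h ih => exact ih.trans (vamosEdges_ctorIdx _ h)

set_option maxRecDepth 20000 in
theorem vamosSource_no_in : ∀ m, ∀ e ∈ vamosEdges, e.2 ≠ vamosSource m := by decide

set_option maxRecDepth 20000 in
theorem vamosSink_no_out : ∀ m, ∀ e ∈ vamosEdges, e.1 ≠ vamosSink m := by decide

/-- The multiple-unicast Vámos network. -/
def vamosNetwork : UnicastNetwork VamosNode VamosMsg where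
  graph := ⟨fun u v => (u, v) ∈ vamosEdges⟩
  source := vamosSource
  sink := vamosSink
  acyclic := fun _ h => lt_irrefl _ (vamosEdges_acyclic h)
  source_injective := by intro m m'; revert m m'; decide
  sink_injective := by intro m m'; revert m m'; decide
  source_no_in := fun m v h => vamosSource_no_in m _ h rfl
  sink_no_out := fun m v h => vamosSink_no_out m _ h rfl

/-- The graph obtained from the multiple-unicast Vámos network by passing to the line graph and
identifying each source with the corresponding target. -/
def vamosGraph : Digraph vamosNetwork.GVertex := vamosNetwork.identifiedGraph

end GraphEntropy

/-! The Vámos rank function obeys Shannon's inequalities but violates the Zhang-Yeung inequality,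
and the graph is built so that a value near `7` forces `f` to be close to that rank function
wherever the violation is read off.

Every vertex repeats one of 14 symbols (`VamosLabel`), so a constrained `f` reduces to a function on
sets of labels, and "is determined by" becomes a finite closure computation (`labelFun_congr`). The
seven messages determine everything, hence `f(V) ≤ 7`. The value `7` is attained by the Vámos rank
function with a line `{m, m₁, m₂}` attached at each of `m = a, c, d`: its rank is `4 + 3`, and it
spans each label by the labels it is computed from (`seven_le_shannonEntropy`).

For the upper bound put `ε = 7 - f(V)`. The eight Vámos labels carry at most `4`, so each auxiliary
message used has conditional value at least `1 - ε` over them. A receiver that recovers a matroid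
element with the help of one such message can therefore nearly do without it: the matroid dependency
holds up to `ε` (`labelFun_insert_le`). For the Vámos rank, the Zhang-Yeung inequality at `{c,y},
{d,z}, {a,w}, {b,x}` would read `2 ≤ 1`; the approximate dependencies change this by a bounded
multiple of `ε`, so `ε` is bounded below (`apply_univ_le_of_isZhangYeung`).

Entropy functions are normalised and satisfy the Zhang-Yeung inequality, which is proved by
adjoining a conditionally independent copy of one variable (`partitionEntropy_zhangYeung`). The
bound does not depend on `s`, so it survives the supremum in `E(G)`. -/

namespace GraphEntropy

/-! ### Entropy of partitions of a finite weighted set -/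

section PartitionEntropy

variable {Ω : Type*} [Fintype Ω]

open Classical in
/-- The mass of the class of `ω` under the partition `r`, for the weights `p`. -/
noncomputable def classMass (p : Ω → ℝ) (r : Setoid Ω) (ω : Ω) : ℝ :=
  ∑ ω', if r ω ω' then p ω' else 0

/-- The entropy (in nats) of the partition `r` of `Ω`, for the weights `p`. The common refinement
of two partitions is their infimum as setoids. -/
noncomputable def partitionEntropy (p : Ω → ℝ) (r : Setoid Ω) : ℝ :=
  -∑ ω, p ω * Real.log (classMass p r ω)

theorem classMass_congr (p : Ω → ℝ) (r : Setoid Ω) {ω ω' : Ω} (h : r ω ω') :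
    classMass p r ω = classMass p r ω' := by
  classical
  refine Finset.sum_congr rfl fun x _ => ?_
  have : r ω x ↔ r ω' x := ⟨fun hx => r.trans (r.symm h) hx, fun hx => r.trans h hx⟩
  simp only [this]

theorem classMass_nonneg {p : Ω → ℝ} (hp : ∀ ω, 0 ≤ p ω) (r : Setoid Ω) (ω : Ω) :
    0 ≤ classMass p r ω := by
  classical
  exact Finset.sum_nonneg fun x _ => by split_ifs <;> simp [hp]

theorem le_classMass {p : Ω → ℝ} (hp : ∀ ω, 0 ≤ p ω) (r : Setoid Ω) (ω : Ω) :
    p ω ≤ classMass p r ω := by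
  classical
  have := Finset.single_le_sum (f := fun x => if r ω x then p x else 0)
    (fun x _ => by split_ifs <;> simp [hp]) (Finset.mem_univ ω)
  simpa [classMass, r.refl ω] using this

theorem classMass_pos {p : Ω → ℝ} (hp : ∀ ω, 0 ≤ p ω) (r : Setoid Ω) {ω : Ω} (h : p ω ≠ 0) :
    0 < classMass p r ω :=
  ((hp ω).lt_of_ne' h).trans_le (le_classMass hp r ω)

/-- Points of weight zero contribute neither to class masses nor to the outer sum. This matters for
the copy construction, where the two copies agree only on the support. -/
theorem partitionEntropy_congr (p : Ω → ℝ) {r t : Setoid Ω}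
    (h : ∀ ω ω', p ω ≠ 0 → p ω' ≠ 0 → (r ω ω' ↔ t ω ω')) :
    partitionEntropy p r = partitionEntropy p t := by
  classical
  unfold partitionEntropy
  congr 1
  refine Finset.sum_congr rfl fun ω _ => ?_
  by_cases hω : p ω = 0
  · simp [hω]
  · congr 2
    refine Finset.sum_congr rfl fun ω' _ => ?_
    by_cases hω' : p ω' = 0
    · simp [hω']
    · simp only [h ω ω' hω hω']

-- The points `ω` that satisfy both conditions form a single class of `x ⊓ y ⊓ z`, or none, and both
-- denominators are constant on it; the mass of that class cancels.
open Classical in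
theorem sum_ratio_aux {p : Ω → ℝ} (hp : ∀ ω, 0 ≤ p ω) (x y z : Setoid Ω) (ω₁ ω₂ : Ω) :
    (∑ ω, if (x ⊓ z) ω ω₁ ∧ (y ⊓ z) ω ω₂ then
        p ω / (classMass p (x ⊓ y ⊓ z) ω * classMass p z ω) else 0)
      ≤ if z ω₁ ω₂ then 1 / classMass p z ω₁ else 0 := by
  by_cases h : ∃ ω, (x ⊓ z) ω ω₁ ∧ (y ⊓ z) ω ω₂
  · obtain ⟨ω₀, ⟨hx, hz⟩, hy, hz'⟩ := h
    rw [if_pos (z.trans (z.symm hz) hz')]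
    have key : ∀ ω, (if (x ⊓ z) ω ω₁ ∧ (y ⊓ z) ω ω₂ then
        p ω / (classMass p (x ⊓ y ⊓ z) ω * classMass p z ω) else 0) =
        (if (x ⊓ y ⊓ z) ω₀ ω then p ω else 0) *
          (1 / (classMass p (x ⊓ y ⊓ z) ω₀ * classMass p z ω₁)) := by
      intro ω
      have hiff : ((x ⊓ z) ω ω₁ ∧ (y ⊓ z) ω ω₂) ↔ (x ⊓ y ⊓ z) ω₀ ω := by
        constructor
        · rintro ⟨⟨h1, h2⟩, h3, h4⟩
          exact ⟨⟨x.trans hx (x.symm h1), y.trans hy (y.symm h3)⟩, z.trans hz (z.symm h2)⟩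
        · rintro ⟨⟨h1, h2⟩, h3⟩
          exact ⟨⟨x.trans (x.symm h1) hx, z.trans (z.symm h3) hz⟩,
            y.trans (y.symm h2) hy, z.trans (z.symm h3) hz'⟩
      by_cases hω : (x ⊓ y ⊓ z) ω₀ ω
      · rw [if_pos (hiff.2 hω), if_pos hω, classMass_congr p _ hω,
          classMass_congr p z (z.trans (z.symm hω.2) hz)]
        ring
      · rw [if_neg (hiff.not.2 hω), if_neg hω, zero_mul]
    rw [Finset.sum_congr rfl fun ω _ => key ω, ← Finset.sum_mul]
    change classMass p (x ⊓ y ⊓ z) ω₀ * _ ≤ _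
    rcases (classMass_nonneg hp (x ⊓ y ⊓ z) ω₀).eq_or_lt with h0 | h0
    · rw [← h0, zero_mul]
      exact div_nonneg zero_le_one (classMass_nonneg hp _ _)
    · rw [one_div, mul_inv, ← mul_assoc, mul_inv_cancel₀ h0.ne', one_mul, one_div]
  · push Not at h
    rw [Finset.sum_eq_zero fun ω _ => if_neg fun hω => h ω hω.1 hω.2]
    split_ifs
    · exact div_nonneg zero_le_one (classMass_nonneg hp _ _)
    · exact le_rfl

/-- The ratio compares the law that makes `x` and `y` conditionally independent given `z` with the
true one. Expanding the two numerator masses and summing over `ω` first leaves a quantity of total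
mass at most that of `p`. -/
theorem sum_ratio_le {p : Ω → ℝ} (hp : ∀ ω, 0 ≤ p ω) (x y z : Setoid Ω) :
    ∑ ω, p ω * (classMass p (x ⊓ z) ω * classMass p (y ⊓ z) ω /
      (classMass p (x ⊓ y ⊓ z) ω * classMass p z ω)) ≤ ∑ ω, p ω := by
  classical
  calc _ = ∑ ω, ∑ ω₁, ∑ ω₂, p ω₁ * p ω₂ * (if (x ⊓ z) ω ω₁ ∧ (y ⊓ z) ω ω₂ then
        p ω / (classMass p (x ⊓ y ⊓ z) ω * classMass p z ω) else 0) := by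
        refine Finset.sum_congr rfl fun ω _ => ?_
        rw [mul_div_assoc', mul_comm (p ω), mul_div_assoc]
        nth_rewrite 1 [classMass]
        nth_rewrite 1 [classMass]
        rw [Finset.sum_mul_sum, Finset.sum_mul]
        refine Finset.sum_congr rfl fun ω₁ _ => ?_
        rw [Finset.sum_mul]
        refine Finset.sum_congr rfl fun ω₂ _ => ?_
        by_cases h1 : (x ⊓ z) ω ω₁ <;> by_cases h2 : (y ⊓ z) ω ω₂ <;> simp [h1, h2]
    _ = ∑ ω₁, ∑ ω₂, p ω₁ * p ω₂ * ∑ ω, (if (x ⊓ z) ω ω₁ ∧ (y ⊓ z) ω ω₂ then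
        p ω / (classMass p (x ⊓ y ⊓ z) ω * classMass p z ω) else 0) := by
        rw [Finset.sum_comm]
        refine Finset.sum_congr rfl fun ω₁ _ => ?_
        rw [Finset.sum_comm]
        exact Finset.sum_congr rfl fun ω₂ _ => (Finset.mul_sum ..).symm
    _ ≤ ∑ ω₁, ∑ ω₂, p ω₁ * p ω₂ * (if z ω₁ ω₂ then 1 / classMass p z ω₁ else 0) := by
        gcongr with ω₁ _ ω₂ _
        · exact mul_nonneg (hp _) (hp _)
        · exact sum_ratio_aux hp x y z ω₁ ω₂
    _ = ∑ ω₁, p ω₁ * (classMass p z ω₁ * (1 / classMass p z ω₁)) := by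
        refine Finset.sum_congr rfl fun ω₁ _ => ?_
        nth_rewrite 2 [classMass]
        rw [Finset.sum_mul, Finset.mul_sum]
        refine Finset.sum_congr rfl fun ω₂ _ => ?_
        split_ifs <;> ring
    _ ≤ ∑ ω, p ω := by
        refine Finset.sum_le_sum fun ω _ => ?_
        by_cases h : p ω = 0
        · simp [h]
        · rw [mul_one_div_cancel (classMass_pos hp z h).ne', mul_one]

/-- Gibbs' inequality: `log t ≤ t - 1` is applied to the ratio of `sum_ratio_le` at each point of
the support. The weights need not sum to one. -/
theorem partitionEntropy_submodular {p : Ω → ℝ} (hp : ∀ ω, 0 ≤ p ω) (x y z : Setoid Ω) :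
    partitionEntropy p (x ⊓ y ⊓ z) + partitionEntropy p z ≤
      partitionEntropy p (x ⊓ z) + partitionEntropy p (y ⊓ z) := by
  have h : ∑ ω, p ω * (Real.log (classMass p (x ⊓ z) ω) + Real.log (classMass p (y ⊓ z) ω)
      - Real.log (classMass p (x ⊓ y ⊓ z) ω) - Real.log (classMass p z ω)) ≤
      ∑ ω, (p ω * (classMass p (x ⊓ z) ω * classMass p (y ⊓ z) ω /
        (classMass p (x ⊓ y ⊓ z) ω * classMass p z ω)) - p ω) := by
    refine Finset.sum_le_sum fun ω _ => ?_
    by_cases h : p ω = 0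
    · simp [h]
    · have h1 := classMass_pos hp (x ⊓ z) h
      have h2 := classMass_pos hp (y ⊓ z) h
      have h3 := classMass_pos hp (x ⊓ y ⊓ z) h
      have h4 := classMass_pos hp z h
      have := Real.log_le_sub_one_of_pos (div_pos (mul_pos h1 h2) (mul_pos h3 h4))
      rw [Real.log_div (mul_pos h1 h2).ne' (mul_pos h3 h4).ne', Real.log_mul h1.ne' h2.ne',
        Real.log_mul h3.ne' h4.ne'] at this
      have := mul_le_mul_of_nonneg_left this (hp ω)
      linarith
  rw [Finset.sum_sub_distrib] at h
  have h' := sum_ratio_le hp x y z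
  simp only [mul_sub, mul_add, Finset.sum_sub_distrib, Finset.sum_add_distrib] at h
  unfold partitionEntropy
  linarith

/-! ### The copy construction and the Zhang-Yeung inequality -/

open Classical in
/-- The weights on `Ω × Ω` of two copies of `(Ω, p)` that agree on the partition `k` and are
conditionally independent given it. -/
noncomputable def copyWeight (p : Ω → ℝ) (k : Setoid Ω) (w : Ω × Ω) : ℝ :=
  if k w.1 w.2 then p w.1 * p w.2 / classMass p k w.1 else 0

theorem copyWeight_nonneg {p : Ω → ℝ} (hp : ∀ ω, 0 ≤ p ω) (k : Setoid Ω) (w : Ω × Ω) :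
    0 ≤ copyWeight p k w := by
  unfold copyWeight
  split_ifs
  · exact div_nonneg (mul_nonneg (hp _) (hp _)) (classMass_nonneg hp _ _)
  · exact le_rfl

theorem rel_of_copyWeight_ne_zero {p : Ω → ℝ} {k : Setoid Ω} {w : Ω × Ω}
    (h : copyWeight p k w ≠ 0) : k w.1 w.2 ∧ p w.1 ≠ 0 ∧ p w.2 ≠ 0 := by
  unfold copyWeight at h
  split_ifs at h with hk
  · refine ⟨hk, ?_, ?_⟩ <;> · intro h0; simp [h0] at h
  · exact absurd rfl h

theorem copyWeight_swap (p : Ω → ℝ) (k : Setoid Ω) (ω ω' : Ω) :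
    copyWeight p k (ω, ω') = copyWeight p k (ω', ω) := by
  unfold copyWeight
  by_cases h : k ω ω'
  · simp only [h, k.symm h, if_true, classMass_congr p k h, mul_comm]
  · have : ¬ k ω' ω := fun h' => h (k.symm h')
    simp only [h, this, if_false]

theorem sum_copyWeight {p : Ω → ℝ} (hp : ∀ ω, 0 ≤ p ω) (k : Setoid Ω) (ω : Ω) :
    ∑ ω', copyWeight p k (ω, ω') = p ω := by
  classical
  by_cases h : p ω = 0
  · simp [copyWeight, h]
  · have : ∀ ω', copyWeight p k (ω, ω') =
        (if k ω ω' then p ω' else 0) * (p ω / classMass p k ω) := by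
      intro ω'
      unfold copyWeight
      dsimp only
      split_ifs <;> ring
    rw [Finset.sum_congr rfl fun ω' _ => this ω', ← Finset.sum_mul]
    exact mul_div_cancel₀ _ (classMass_pos hp k h).ne'

theorem classMass_copy_fst {p : Ω → ℝ} (hp : ∀ ω, 0 ≤ p ω) (k r : Setoid Ω) (w : Ω × Ω) :
    classMass (copyWeight p k) (r.comap Prod.fst) w = classMass p r w.1 := by
  classical
  unfold classMass
  rw [Fintype.sum_prod_type]
  refine Finset.sum_congr rfl fun ω _ => ?_
  simp only [Setoid.comap_rel]
  split_ifs
  · exact sum_copyWeight hp k ω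
  · simp

theorem classMass_copy_snd {p : Ω → ℝ} (hp : ∀ ω, 0 ≤ p ω) (k r : Setoid Ω) (w : Ω × Ω) :
    classMass (copyWeight p k) (r.comap Prod.snd) w = classMass p r w.2 := by
  classical
  unfold classMass
  rw [Fintype.sum_prod_type_right]
  refine Finset.sum_congr rfl fun ω _ => ?_
  simp only [Setoid.comap_rel, copyWeight_swap p k _ ω]
  split_ifs
  · exact sum_copyWeight hp k ω
  · simp

theorem partitionEntropy_copy_fst {p : Ω → ℝ} (hp : ∀ ω, 0 ≤ p ω) (k r : Setoid Ω) :
    partitionEntropy (copyWeight p k) (r.comap Prod.fst) = partitionEntropy p r := by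
  unfold partitionEntropy
  rw [Fintype.sum_prod_type]
  simp only [classMass_copy_fst hp, ← Finset.sum_mul, sum_copyWeight hp]

theorem partitionEntropy_copy_snd {p : Ω → ℝ} (hp : ∀ ω, 0 ≤ p ω) (k r : Setoid Ω) :
    partitionEntropy (copyWeight p k) (r.comap Prod.snd) = partitionEntropy p r := by
  unfold partitionEntropy
  rw [Fintype.sum_prod_type_right]
  simp only [classMass_copy_snd hp, ← Finset.sum_mul, copyWeight_swap p k _, sum_copyWeight hp]

/-- Conditional independence given `k`: as `r` and `t` refine `k`, class masses of the pair factor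
as a product divided by the mass of the `k`-class, and logarithms add. -/
theorem partitionEntropy_copy_inf {p : Ω → ℝ} (hp : ∀ ω, 0 ≤ p ω) {k r t : Setoid Ω}
    (hr : r ≤ k) (ht : t ≤ k) :
    partitionEntropy (copyWeight p k) (r.comap Prod.fst ⊓ t.comap Prod.snd) =
      partitionEntropy p r + partitionEntropy p t - partitionEntropy p k := by
  classical
  have hm : ∀ w : Ω × Ω, k w.1 w.2 →
      classMass (copyWeight p k) (r.comap Prod.fst ⊓ t.comap Prod.snd) w =
        classMass p r w.1 * classMass p t w.2 / classMass p k w.1 := by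
    intro w hw
    rw [mul_div_assoc]
    nth_rewrite 1 [classMass]
    nth_rewrite 1 [classMass]
    nth_rewrite 1 [classMass]
    rw [Fintype.sum_prod_type, Finset.sum_div, Finset.sum_mul_sum]
    refine Finset.sum_congr rfl fun ω _ => Finset.sum_congr rfl fun ω' _ => ?_
    have hiff : (r.comap Prod.fst ⊓ t.comap Prod.snd) w (ω, ω') ↔ r w.1 ω ∧ t w.2 ω' := Iff.rfl
    by_cases h1 : r w.1 ω
    · by_cases h2 : t w.2 ω'
      · have h3 : k ω ω' := k.trans (k.trans (k.symm (hr h1)) hw) (ht h2)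
        rw [if_pos (hiff.2 ⟨h1, h2⟩), if_pos h1, if_pos h2, copyWeight, if_pos h3,
          classMass_congr p k (hr h1)]
        ring
      · rw [if_neg fun h => h2 (hiff.1 h).2, if_neg h2]
        simp
    · rw [if_neg fun h => h1 (hiff.1 h).1, if_neg h1]
      simp
  rw [← partitionEntropy_copy_fst hp k r, ← partitionEntropy_copy_snd hp k t,
    ← partitionEntropy_copy_fst hp k k]
  unfold partitionEntropy
  simp only [classMass_copy_fst hp, classMass_copy_snd hp]
  rw [← neg_add, ← Finset.sum_add_distrib, neg_sub_neg, ← Finset.sum_sub_distrib,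
    ← Finset.sum_neg_distrib]
  refine Finset.sum_congr rfl fun w _ => ?_
  by_cases h : copyWeight p k w = 0
  · simp [h]
  · obtain ⟨hk, h1, h2⟩ := rel_of_copyWeight_ne_zero h
    have p1 := (classMass_pos hp r h1).ne'
    have p2 := (classMass_pos hp t h2).ne'
    have p3 := (classMass_pos hp k h1).ne'
    rw [hm w hk, Real.log_div (mul_ne_zero p1 p2) p3, Real.log_mul p1 p2]
    ring

/-- On the support of the copy weights the two copies of a partition coarser than `k` agree. -/
theorem partitionEntropy_copy_snd_inf_fst {p : Ω → ℝ} (hp : ∀ ω, 0 ≤ p ω) {k : Setoid Ω}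
    (a : Setoid Ω) {c : Setoid Ω} (hc : k ≤ c) :
    partitionEntropy (copyWeight p k) (a.comap Prod.snd ⊓ c.comap Prod.fst) =
      partitionEntropy p (a ⊓ c) := by
  rw [← partitionEntropy_copy_snd hp k]
  refine partitionEntropy_congr _ fun w w' hw hw' => ?_
  have h := hc (rel_of_copyWeight_ne_zero hw).1
  have h' := hc (rel_of_copyWeight_ne_zero hw').1
  exact and_congr_right fun _ =>
    ⟨fun h1 => c.trans (c.symm h) (c.trans h1 h'), fun h1 => c.trans h (c.trans h1 (c.symm h'))⟩

/-- The Zhang-Yeung inequality for four partitions of a finite weighted set. -/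
theorem partitionEntropy_zhangYeung {p : Ω → ℝ} (hp : ∀ ω, 0 ≤ p ω) (a b c d : Setoid Ω) :
    let H := partitionEntropy p
    2 * (H c + H d - H (c ⊓ d)) ≤
      (H a + H b - H (a ⊓ b)) + (H a + H (c ⊓ d) - H (a ⊓ c ⊓ d))
        + 3 * (H (a ⊓ c) + H (a ⊓ d) - H (a ⊓ c ⊓ d) - H a)
        + (H (b ⊓ c) + H (b ⊓ d) - H (b ⊓ c ⊓ d) - H b) := by
  intro H
  set k := c ⊓ d with hk
  have hq := copyWeight_nonneg hp k
  set Q := partitionEntropy (copyWeight p k) with hQ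
  set A := a.comap (Prod.fst : Ω × Ω → Ω) with hA
  set B := b.comap (Prod.fst : Ω × Ω → Ω) with hB
  set C := c.comap (Prod.fst : Ω × Ω → Ω) with hC
  set D := d.comap (Prod.fst : Ω × Ω → Ω) with hD
  -- `R` is the auxiliary variable: a second copy of `a`, with the same joint entropies with `c` and
  -- with `d`, but independent of the first coordinate given `k = c ⊓ d`.
  set R := a.comap (Prod.snd : Ω × Ω → Ω) with hR
  have sub : ∀ x y z, Q (x ⊓ y ⊓ z) + Q z ≤ Q (x ⊓ z) + Q (y ⊓ z) :=
    partitionEntropy_submodular hq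
  have fst : ∀ r : Setoid Ω, Q (r.comap Prod.fst) = H r := partitionEntropy_copy_fst hp k
  have indep : ∀ r : Setoid Ω, r ≤ k →
      Q (R ⊓ r.comap Prod.fst) = H r + H (a ⊓ k) - H k := by
    intro r hr
    rw [← partitionEntropy_copy_inf hp hr inf_le_right]
    refine partitionEntropy_congr _ fun w w' hw hw' => ?_
    have h := (rel_of_copyWeight_ne_zero hw).1
    have h' := (rel_of_copyWeight_ne_zero hw').1
    exact ⟨fun h1 => ⟨h1.2, h1.1, k.trans (k.symm h) (k.trans (hr h1.2) h')⟩,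
      fun h1 => ⟨h1.2.1, h1.1⟩⟩
  -- Sum of `I(R; X | C) ≥ 0`, `I(R; X | D) ≥ 0` and `I(C; D | R X) ≥ 0`, with the entropy of `C D R
  -- X` evaluated by conditional independence. It bounds `Q (R ⊓ X)` from above.
  have single : ∀ x : Setoid Ω,
      H (x ⊓ k) + H (a ⊓ k) - H k + Q (R ⊓ x.comap Prod.fst) + H c + H d ≤
        H (a ⊓ c) + H (a ⊓ d) + H (x ⊓ c) + H (x ⊓ d) := by
    intro x
    set X := x.comap (Prod.fst : Ω × Ω → Ω) with hX
    have h1 := sub R X C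
    have h2 := sub R X D
    have h3 := sub C D (R ⊓ X)
    have e1 : C ⊓ D ⊓ (R ⊓ X) = R ⊓ (x ⊓ k).comap Prod.fst := by
      change _ = R ⊓ (X ⊓ (C ⊓ D))
      ac_rfl
    have e2 : Q (R ⊓ C) = H (a ⊓ c) := partitionEntropy_copy_snd_inf_fst hp a inf_le_left
    have e3 : Q (R ⊓ D) = H (a ⊓ d) := partitionEntropy_copy_snd_inf_fst hp a inf_le_right
    have e4 : Q (X ⊓ C) = H (x ⊓ c) := fst (x ⊓ c)
    have e5 : Q (X ⊓ D) = H (x ⊓ d) := fst (x ⊓ d)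
    have e6 : Q C = H c := fst c
    have e7 : Q D = H d := fst d
    rw [e1, indep _ inf_le_right, inf_comm C, inf_comm D] at h3
    linarith
  have ha := single a
  have hb := single b
  -- `I(A; B | R) ≥ 0` and `I(R; C D | A B) ≥ 0` bound `Q (R ⊓ A) + Q (R ⊓ B)` from below; the two
  -- instances of `single` bound it from above.
  have h1 := sub A B R
  have h2 := sub R (C ⊓ D) (A ⊓ B)
  have e1 : R ⊓ (C ⊓ D) ⊓ (A ⊓ B) = R ⊓ (a ⊓ b ⊓ k).comap Prod.fst := by
    change _ = R ⊓ (A ⊓ B ⊓ (C ⊓ D))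
    ac_rfl
  have e2 : Q (C ⊓ D ⊓ (A ⊓ B)) = H (a ⊓ b ⊓ k) := by
    rw [inf_comm]
    exact fst (a ⊓ b ⊓ k)
  have e3 : Q (A ⊓ B) = H (a ⊓ b) := fst (a ⊓ b)
  have e4 : Q R = H a := partitionEntropy_copy_snd hp k a
  have e5 : R ⊓ (A ⊓ B) = A ⊓ B ⊓ R := inf_comm _ _
  rw [e1, indep _ inf_le_right, e5] at h2
  rw [inf_comm A R, inf_comm B R] at h1
  rw [inf_assoc a c d, inf_assoc b c d, ← hk]
  linarith

end PartitionEntropy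

/-! ### Entropy functions of distributions on `A^V` -/

section EntropyFun

variable {V : Type*} {s : ℕ}

/-- The partition of `A^V` according to the coordinates in `S`. -/
def agreeOn (s : ℕ) (S : Set V) : Setoid (V → Fin s) where
  r x y := ∀ i ∈ S, x i = y i
  iseqv := ⟨fun _ _ _ => rfl, fun h i hi => (h i hi).symm,
    fun h h' i hi => (h i hi).trans (h' i hi)⟩

theorem agreeOn_union (S T : Set V) : agreeOn s (S ∪ T) = agreeOn s S ⊓ agreeOn s T := by
  ext x y
  exact ⟨fun h => ⟨fun i hi => h i (.inl hi), fun i hi => h i (.inr hi)⟩,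
    fun h i hi => hi.elim (h.1 i) (h.2 i)⟩

variable [Fintype V]

open Classical in
theorem entropyFun_eq (p : (V → Fin s) → ℝ) (S : Set V) :
    entropyFun p S = partitionEntropy p (agreeOn s S) / Real.log s := by
  classical
  have hm : ∀ x : V → Fin s,
      marginal p S (fun i => x i) = classMass p (agreeOn s S) x := by
    intro x
    refine Finset.sum_congr rfl fun y _ => ?_
    have : (∀ i : S, y i = x i) ↔ agreeOn s S x y :=
      ⟨fun h i hi => (h ⟨i, hi⟩).symm, fun h i => (h i i.2).symm⟩
    simp only [this]
  calc entropyFun p S = ∑ u : S → Fin s, ∑ x : V → Fin s, if u = (fun i : S => x i) then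
        p x * Real.logb s (1 / marginal p S u) else 0 := by
        refine Finset.sum_congr rfl fun u _ => ?_
        nth_rewrite 1 [marginal]
        rw [Finset.sum_mul]
        refine Finset.sum_congr rfl fun x _ => ?_
        have : (∀ i : S, x i = u i) ↔ u = (fun i : S => x i) :=
          ⟨fun h => funext fun i => (h i).symm, fun h i => by rw [h]⟩
        simp only [this, ite_mul, zero_mul]
    _ = ∑ x, p x * Real.logb s (1 / classMass p (agreeOn s S) x) := by
        rw [Finset.sum_comm]
        refine Finset.sum_congr rfl fun x _ => ?_
        rw [Finset.sum_ite_eq' Finset.univ, if_pos (Finset.mem_univ _), hm]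
    _ = _ := by
        rw [partitionEntropy, neg_div, Finset.sum_div, ← Finset.sum_neg_distrib]
        refine Finset.sum_congr rfl fun x _ => ?_
        rw [Real.logb, one_div, Real.log_inv]
        ring

open Classical in
theorem partitionEntropy_agreeOn_empty {p : (V → Fin s) → ℝ} (hp1 : ∑ x, p x = 1) :
    partitionEntropy p (agreeOn s (∅ : Set V)) = 0 := by
  have h : ∀ x, classMass p (agreeOn s (∅ : Set V)) x = 1 := by
    intro x
    rw [← hp1]
    exact Finset.sum_congr rfl fun y _ => if_pos fun i hi => hi.elim
  rw [partitionEntropy]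
  simp [h]

open Classical in
/-- Entropy functions satisfy the Zhang-Yeung inequality. -/
theorem isZhangYeung_entropyFun {p : (V → Fin s) → ℝ} (hp : ∀ x, 0 ≤ p x)
    (hp1 : ∑ x, p x = 1) : IsZhangYeung (entropyFun p) where
  empty := by rw [entropyFun_eq, partitionEntropy_agreeOn_empty hp1, zero_div]
  zhangYeung := by
    intro A B C D
    have h := partitionEntropy_zhangYeung hp (agreeOn s A) (agreeOn s B) (agreeOn s C)
      (agreeOn s D)
    have h0 := partitionEntropy_agreeOn_empty hp1
    -- Nonnegativity is enough: for `s ≤ 1` the logarithm is `0` and all quotients by it are `0`.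
    have hs : 0 ≤ Real.log s := Real.log_natCast_nonneg s
    have e1 : C ∪ D ∪ A = A ∪ C ∪ D := by ac_rfl
    have e2 : C ∪ D ∪ B = B ∪ C ∪ D := by ac_rfl
    have e3 : A ∪ (C ∪ D) = A ∪ C ∪ D := by ac_rfl
    simp only [mutualInfo, Set.union_empty, entropyFun_eq, e1, e2, e3, Set.union_comm C A,
      Set.union_comm D A, Set.union_comm C B, Set.union_comm D B, h0]
    simp only [← agreeOn_union] at h
    have h' := div_le_div_of_nonneg_right h hs
    ring_nf at h' ⊢
    linarith

open Classical in
theorem isNormalized_entropyFun {p : (V → Fin s) → ℝ} (hp : ∀ x, 0 ≤ p x)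
    (hp1 : ∑ x, p x = 1) (hs : 2 ≤ s) : IsNormalized (entropyFun p) := by
  intro j
  obtain ⟨S, hS⟩ : ∃ S : Set V, S = {j} := ⟨_, rfl⟩
  rw [← hS]
  have hs0 : (0 : ℝ) < s := by positivity
  have hlog : 0 < Real.log s := Real.log_pos (by exact_mod_cast hs)
  have hmass : ∑ u : S → Fin s, marginal p S u = 1 := by
    unfold marginal
    rw [Finset.sum_comm, ← hp1]
    refine Finset.sum_congr rfl fun x _ => ?_
    have : ∀ u : S → Fin s,
        (∀ i : S, x i = u i) ↔ u = fun i : S => x i := fun u =>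
      ⟨fun h => funext fun i => (h i).symm, fun h i => by rw [h]⟩
    simp only [this]
    rw [Finset.sum_ite_eq' Finset.univ, if_pos (Finset.mem_univ _)]
  -- This is `log t ≤ t - 1` at `t = 1 / (s q)`, with `q` the marginal probability. Over the `s`
  -- values of `u` the corrections `1 / s - q` sum to zero.
  have hterm : ∀ u : S → Fin s,
      marginal p S u * Real.logb s (1 / marginal p S u) ≤
        marginal p S u + (1 / s - marginal p S u) / Real.log s := by
    intro u
    have h0 : 0 ≤ marginal p S u :=
      Finset.sum_nonneg fun x _ => by split_ifs <;> simp [hp]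
    rcases h0.eq_or_lt with h | h
    · rw [← h]
      simp only [zero_mul, zero_add, sub_zero]
      positivity
    · have h1 := Real.log_le_sub_one_of_pos (inv_pos.2 (mul_pos hs0 h))
      rw [Real.log_inv, Real.log_mul hs0.ne' h.ne'] at h1
      have h2 := mul_le_mul_of_nonneg_left h1 h.le
      have h3 : marginal p S u * ((s * marginal p S u)⁻¹ - 1) =
          1 / s - marginal p S u := by field_simp
      rw [h3] at h2
      rw [Real.logb, one_div, Real.log_inv, mul_div_assoc', div_le_iff₀ hlog, add_mul,
        div_mul_cancel₀ _ hlog.ne']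
      linarith
  calc entropyFun p S ≤ ∑ u : S → Fin s,
        (marginal p S u + (1 / s - marginal p S u) / Real.log s) :=
        Finset.sum_le_sum fun u _ => hterm u
    _ = 1 := by
        rw [Finset.sum_add_distrib, ← Finset.sum_div, Finset.sum_sub_distrib, hmass]
        have hc : Fintype.card S = 1 := by
          rw [← Nat.card_eq_fintype_card, hS]
          simp
        simp [hs0.ne', hc]

end EntropyFun

/-! ### Functional dependence for Shannon functions -/

section Determined

variable {V : Type*} {f : Set V → ℝ}

theorem IsZhangYeung.isShannon (hf : IsZhangYeung f) : IsShannon f where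
  empty := hf.empty
  shannon X Y Z := by
    -- The information of `X ∪ Z` and `Y ∪ Z` exceeds its version given `Z` by exactly `f Z`, so the
    -- inequality collapses to `0 ≤ 2 I(X; Y | Z)`.
    have h := hf.zhangYeung Z ∅ (X ∪ Z) (Y ∪ Z)
    have e1 : X ∪ Z ∪ (Y ∪ Z) = X ∪ Y ∪ Z := by ext; simp; tauto
    have e2 : Z ∪ (X ∪ Y ∪ Z) = X ∪ Y ∪ Z := by ext; simp; tauto
    simp only [mutualInfo, Set.union_empty, hf.empty, Set.union_assoc _ Z Z, Set.union_self, e1,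
      e2] at h
    linarith

theorem IsShannon.mono (hf : IsShannon f) {S T : Set V} (h : S ⊆ T) : f S ≤ f T := by
  have := hf.shannon T T S
  rw [Set.union_self, Set.union_eq_left.2 h] at this
  linarith

/-- The set `S` determines the vertex `v`. -/
def Determines (f : Set V → ℝ) (S : Set V) (v : V) : Prop := f (insert v S) = f S

theorem IsShannon.determines_mono (hf : IsShannon f) {S T : Set V} (h : S ⊆ T) {v : V}
    (hv : Determines f S v) : Determines f T v := by
  have := hf.shannon {v} T S
  have e : {v} ∪ T ∪ S = insert v T := by
    rw [Set.union_assoc, Set.union_eq_left.2 h, Set.singleton_union]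
  rw [e, Set.union_eq_left.2 h, Set.singleton_union, hv] at this
  exact le_antisymm (by linarith) (hf.mono (Set.subset_insert v T))

theorem determines_of_mem {S : Set V} {v : V} (h : v ∈ S) : Determines f S v := by
  rw [Determines, Set.insert_eq_of_mem h]

theorem IsShannon.union_eq_of_determines [Finite V] (hf : IsShannon f) {S T : Set V}
    (h : ∀ v ∈ T, Determines f S v) : f (S ∪ T) = f S := by
  induction T, T.toFinite using Set.Finite.induction_on with
  | empty => rw [Set.union_empty]
  | @insert v T _ _ ih =>
    rw [Set.union_insert,
      hf.determines_mono Set.subset_union_left (h v (Set.mem_insert v T)),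
      ih fun u hu => h u (Set.mem_insert_of_mem v hu)]

theorem IsShannon.determines_trans [Finite V] (hf : IsShannon f) {S T : Set V}
    (h : ∀ v ∈ T, Determines f S v) {v : V} (hv : Determines f T v) : Determines f S v := by
  have h1 := hf.determines_mono (Set.subset_union_right (s := S)) hv
  rw [Determines, hf.union_eq_of_determines h] at h1
  refine le_antisymm ?_ (hf.mono (Set.subset_insert v S))
  rw [← h1]
  exact hf.mono (Set.insert_subset_insert Set.subset_union_left)

theorem IsShannon.comp_image {L : Type*} (r : L → V) (hf : IsShannon f) :
    IsShannon fun S => f (r '' S) where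
  empty := by simpa using hf.empty
  shannon X Y Z := by simpa only [Set.image_union] using hf.shannon (r '' X) (r '' Y) (r '' Z)

theorem IsZhangYeung.comp_image {L : Type*} (r : L → V) (hf : IsZhangYeung f) :
    IsZhangYeung fun S => f (r '' S) where
  empty := by simpa using hf.empty
  zhangYeung A B C D := by
    simpa only [mutualInfo, Set.image_union, Set.image_empty] using
      hf.zhangYeung (r '' A) (r '' B) (r '' C) (r '' D)

end Determined

/-! ### The symbols carried by the vertices of the Vámos graph -/

section Labels

/-- The symbols that are carried by the Vámos network: seven messages, of which `b` belongs to the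
Vámos matroid, and the other seven elements of the Vámos matroid. -/
inductive VamosLabel
  | a1 | a2 | b | c1 | c2 | d1 | d2 | a | c | d | w | x | y | z
  deriving DecidableEq

instance : Fintype VamosLabel :=
  ⟨{.a1, .a2, .b, .c1, .c2, .d1, .d2, .a, .c, .d, .w, .x, .y, .z}, by
    intro m; cases m <;> decide⟩

namespace VamosLabel

/-- The label of a message. -/
def ofMsg : VamosMsg → VamosLabel
  | .a1 => a1 | .a2 => a2 | .b => b | .c1 => c1 | .c2 => c2 | .d1 => d1 | .d2 => d2

/-- The label of the symbol on the edges that leave a node. -/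
def ofTail : VamosNode → VamosLabel
  | .sa1 => a1 | .sa2 => a2 | .sb => b | .sc1 => c1 | .sc2 => c2 | .sd1 => d1 | .sd2 => d2
  | .ja | .ka => a | .jc | .kc => c | .jd | .kd => d
  | .n1 | .n2 => w | .n3 | .n4 => x | .n5 | .n6 => y | .n7 | .n8 => z
  -- Only receivers remain; no edge leaves them, so the value is immaterial.
  | _ => a

/-- The labels from which each label is computed. -/
def deps : VamosLabel → Finset VamosLabel
  | a => {a1, a2} | c => {c1, c2} | d => {d1, d2}
  | w => {a, b, c, d} | x => {a, b, w} | y => {a, c, w} | z => {a, d, w}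
  | d1 => {a, b, c, w, d2} | c1 => {a, b, d, w, c2} | a1 => {b, w, x, a2}
  | a2 => {c, d, y, z, a1} | b => {c, d, y, z} | c2 => {b, x, y, c1} | d2 => {b, x, z, d1}

/-- A vertex that carries the label. -/
def rep : VamosLabel → vamosNetwork.GVertex
  | a1 => .inl .a1 | a2 => .inl .a2 | b => .inl .b | c1 => .inl .c1 | c2 => .inl .c2
  | d1 => .inl .d1 | d2 => .inl .d2
  | a => .inr ⟨(.ja, .ka), by change _ ∈ vamosEdges; decide⟩
  | c => .inr ⟨(.jc, .kc), by change _ ∈ vamosEdges; decide⟩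
  | d => .inr ⟨(.jd, .kd), by change _ ∈ vamosEdges; decide⟩
  | w => .inr ⟨(.n1, .n2), by change _ ∈ vamosEdges; decide⟩
  | x => .inr ⟨(.n3, .n4), by change _ ∈ vamosEdges; decide⟩
  | y => .inr ⟨(.n5, .n6), by change _ ∈ vamosEdges; decide⟩
  | z => .inr ⟨(.n7, .n8), by change _ ∈ vamosEdges; decide⟩

end VamosLabel

/-- The label of a vertex. -/
def vamosLabel : vamosNetwork.GVertex → VamosLabel
  | .inl m => .ofMsg m
  | .inr e => .ofTail e.1.1

/-- A vertex of the Vámos graph, as a message or a pair of nodes. -/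
def rawVertex : vamosNetwork.GVertex → VamosMsg ⊕ (VamosNode × VamosNode)
  | .inl m => .inl m
  | .inr e => .inr e.1

theorem rawVertex_injective : Function.Injective rawVertex := by
  rintro (m | e) (m' | e') h
  · exact congrArg Sum.inl (Sum.inl.inj h)
  · cases h
  · cases h
  · exact congrArg Sum.inr (Subtype.ext (Sum.inr.inj h))

/-- The label of a message or a pair of nodes. -/
def rawLabel : VamosMsg ⊕ (VamosNode × VamosNode) → VamosLabel
  | .inl m => .ofMsg m
  | .inr e => .ofTail e.1

theorem rawLabel_rawVertex (v : vamosNetwork.GVertex) :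
    rawLabel (rawVertex v) = vamosLabel v := by
  cases v <;> rfl

/-- The vertices of the Vámos graph, listed. -/
def rawVertices : List (VamosMsg ⊕ (VamosNode × VamosNode)) :=
  [VamosMsg.a1, .a2, .b, .c1, .c2, .d1, .d2].map .inl ++ vamosEdges.map .inr

theorem rawVertex_mem (v : vamosNetwork.GVertex) : rawVertex v ∈ rawVertices := by
  rcases v with m | e
  · refine List.mem_append_left _ (List.mem_map_of_mem ?_)
    cases m <;> decide
  · exact List.mem_append_right _ (List.mem_map_of_mem e.2)

theorem exists_rawVertex_eq {v} (h : v ∈ rawVertices) : ∃ u, rawVertex u = v := by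
  rcases List.mem_append.1 h with h | h
  · obtain ⟨m, -, rfl⟩ := List.mem_map.1 h
    exact ⟨.inl m, rfl⟩
  · obtain ⟨e, he, rfl⟩ := List.mem_map.1 h
    exact ⟨.inr ⟨e, he⟩, rfl⟩

/-- Adjacency of the Vámos graph, as a decidable relation. -/
def rawAdj : VamosMsg ⊕ (VamosNode × VamosNode) → VamosMsg ⊕ (VamosNode × VamosNode) → Bool
  | .inl _, .inl _ => false
  | .inl m, .inr e => vamosSource m = e.1
  | .inr e, .inr e' => e.2 = e'.1
  | .inr e, .inl m => e.2 = vamosSink m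

theorem vamosGraph_adj_iff (u v : vamosNetwork.GVertex) :
    vamosGraph.Adj u v ↔ rawAdj (rawVertex u) (rawVertex v) = true := by
  constructor
  · rintro ⟨u', v', h, rfl, rfl⟩
    cases h with
    | input_edge m e h => exact decide_eq_true h
    | edge_edge e e' h => exact decide_eq_true h
    | edge_output e m h => exact decide_eq_true h
    | input_output m m' h =>
      have : ∀ m m', vamosSource m ≠ vamosSink m' := by decide
      exact absurd h (this m m')
  · intro h
    rcases u with m | e <;> rcases v with m' | e'
    · cases h
    · exact ⟨.input m, .edge e', .input_edge m e' (of_decide_eq_true h), rfl, rfl⟩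
    · exact ⟨.edge e, .output m', .edge_output e m' (of_decide_eq_true h), rfl, rfl⟩
    · exact ⟨.edge e, .edge e', .edge_edge e e' (of_decide_eq_true h), rfl, rfl⟩

theorem vamosLabel_rep (l : VamosLabel) : vamosLabel l.rep = l := by cases l <;> rfl

-- The first clause makes each vertex a function of the representative of its label, for the upper
-- bounds. The second makes a function pulled back from labels satisfy the constraints, for the
-- lower bound.
set_option maxRecDepth 100000 in
theorem raw_preds : ∀ v ∈ rawVertices,
    (v = rawVertex (rawLabel v).rep ∨
      ∀ u ∈ rawVertices, rawAdj u v → u = rawVertex (rawLabel v).rep) ∧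
    ((∃ u ∈ rawVertices, rawAdj u v ∧ rawLabel u = rawLabel v) ∨
      ∀ l ∈ (rawLabel v).deps, ∃ u ∈ rawVertices, rawAdj u v ∧ rawLabel u = l) := by
  decide

set_option maxRecDepth 100000 in
theorem raw_preds_rep : ∀ l : VamosLabel, ∀ u ∈ rawVertices,
    rawAdj u (rawVertex l.rep) → rawLabel u ∈ l.deps := by
  decide

end Labels

/-! ### Upper bounds for functions on the Vámos graph -/

section LabelFunction

theorem preds_cases (v : vamosNetwork.GVertex) :
    (v = (vamosLabel v).rep ∨ preds vamosGraph v ⊆ {(vamosLabel v).rep}) ∧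
      (vamosLabel v ∈ vamosLabel '' preds vamosGraph v ∨
        ↑(vamosLabel v).deps ⊆ vamosLabel '' preds vamosGraph v) := by
  have h := raw_preds _ (rawVertex_mem v)
  simp only [rawLabel_rawVertex] at h
  have key : ∀ l, (∃ u ∈ rawVertices, rawAdj u (rawVertex v) ∧ rawLabel u = l) →
      l ∈ vamosLabel '' preds vamosGraph v := by
    rintro l ⟨u, hu, hadj, rfl⟩
    obtain ⟨u, rfl⟩ := exists_rawVertex_eq hu
    exact ⟨u, (vamosGraph_adj_iff u v).2 hadj, (rawLabel_rawVertex u).symm⟩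
  refine ⟨h.1.imp (fun h => rawVertex_injective h) fun h u hu => ?_,
    h.2.imp (key _) fun h l hl => key l (h l hl)⟩
  exact rawVertex_injective (h _ (rawVertex_mem u) ((vamosGraph_adj_iff u v).1 hu))

theorem label_mem_deps {l : VamosLabel} {u : vamosNetwork.GVertex}
    (h : u ∈ preds vamosGraph l.rep) : vamosLabel u ∈ l.deps := by
  rw [← rawLabel_rawVertex]
  exact raw_preds_rep l _ (rawVertex_mem u) ((vamosGraph_adj_iff u l.rep).1 h)

/-- The labels that are computed from a set of labels in one step, together with that set. -/
def VamosLabel.step (S : Finset VamosLabel) : Finset VamosLabel :=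
  S ∪ Finset.univ.filter fun l => l.deps ⊆ S

/-- The labels that are computed from a set of labels. -/
def VamosLabel.closure (S : Finset VamosLabel) : Finset VamosLabel :=
  VamosLabel.step (VamosLabel.step (VamosLabel.step (VamosLabel.step (VamosLabel.step S))))

variable {f : Set vamosNetwork.GVertex → ℝ}

/-- The function on sets of labels that is induced by a function on sets of vertices. -/
def labelFun (f : Set vamosNetwork.GVertex → ℝ) (S : Finset VamosLabel) : ℝ :=
  f (VamosLabel.rep '' S)

theorem determines_preds (hc : SatisfiesConstraints vamosGraph f) (v : vamosNetwork.GVertex) :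
    Determines f (preds vamosGraph v) v := by
  have h := hc v
  rw [cond, Set.singleton_union] at h
  exact sub_eq_zero.1 h

theorem determines_rep_label (hf : IsShannon f) (hc : SatisfiesConstraints vamosGraph f)
    (v : vamosNetwork.GVertex) : Determines f {(vamosLabel v).rep} v := by
  rcases (preds_cases v).1 with h | h
  · exact determines_of_mem h
  · exact hf.determines_mono h (determines_preds hc v)

theorem determines_rep (hf : IsShannon f) (hc : SatisfiesConstraints vamosGraph f)
    {l : VamosLabel} {S : Finset VamosLabel} (h : l.deps ⊆ S) :
    Determines f (VamosLabel.rep '' S) l.rep :=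
  hf.determines_trans (fun u hu => hf.determines_mono
    (Set.singleton_subset_iff.2
      (Set.mem_image_of_mem _ (Finset.mem_coe.2 (h (label_mem_deps hu))))) (determines_rep_label hf hc u))
    (determines_preds hc l.rep)

theorem labelFun_step (hf : IsShannon f) (hc : SatisfiesConstraints vamosGraph f)
    (S : Finset VamosLabel) : labelFun f (VamosLabel.step S) = labelFun f S := by
  unfold labelFun VamosLabel.step
  rw [Finset.coe_union, Set.image_union]
  refine hf.union_eq_of_determines ?_
  rintro _ ⟨l, hl, rfl⟩
  exact determines_rep hf hc (by simpa using hl)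

/-- Each round of `step` adds only determined labels, so the value is unchanged. The five rounds in
`closure` need not reach a closed set for this; they are enough for every comparison made below. -/
theorem labelFun_congr (hf : IsShannon f) (hc : SatisfiesConstraints vamosGraph f)
    {S T : Finset VamosLabel} (h : VamosLabel.closure S = VamosLabel.closure T) :
    labelFun f S = labelFun f T := by
  have key : ∀ S, labelFun f (VamosLabel.closure S) = labelFun f S := fun S => by
    simp only [VamosLabel.closure, labelFun_step hf hc]
  rw [← key S, h, key]

theorem labelFun_univ (hf : IsShannon f) (hc : SatisfiesConstraints vamosGraph f) :
    labelFun f Finset.univ = f Set.univ := by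
  rw [labelFun, Finset.coe_univ]
  have := hf.union_eq_of_determines (S := VamosLabel.rep '' Set.univ) (T := Set.univ)
    fun v _ => hf.determines_mono (by simp) (determines_rep_label hf hc v)
  rw [← this, Set.union_univ]

theorem labelFun_union_add_inter_le (hf : IsShannon f) (S T : Finset VamosLabel) :
    labelFun f (S ∪ T) + labelFun f (S ∩ T) ≤ labelFun f S + labelFun f T := by
  have h := (hf.comp_image VamosLabel.rep).shannon S T ↑(S ∩ T)
  have e1 : (S : Set VamosLabel) ∪ T ∪ ↑(S ∩ T) = ↑(S ∪ T) := by ext; simp; tauto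
  have e2 : (S : Set VamosLabel) ∪ ↑(S ∩ T) = S := by ext; simp; tauto
  have e3 : (T : Set VamosLabel) ∪ ↑(S ∩ T) = T := by ext; simp
  rw [e1, e2, e3] at h
  unfold labelFun
  linarith

theorem labelFun_mono (hf : IsShannon f) {S T : Finset VamosLabel} (h : S ⊆ T) :
    labelFun f S ≤ labelFun f T :=
  hf.mono (Set.image_mono (by exact_mod_cast h))

theorem labelFun_empty (hf : IsShannon f) : labelFun f ∅ = 0 := by
  simpa [labelFun] using hf.empty

theorem labelFun_union_le (hf : IsShannon f) (hn : IsNormalized f) (S T : Finset VamosLabel) :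
    labelFun f (S ∪ T) ≤ labelFun f S + T.card := by
  induction T using Finset.induction_on with
  | empty => simp
  | @insert l T hl ih =>
    have h1 := labelFun_union_add_inter_le hf (S ∪ T) {l}
    have h2 : labelFun f {l} ≤ 1 := by simpa [labelFun] using hn l.rep
    have h4 : 0 ≤ labelFun f ((S ∪ T) ∩ {l}) := by
      rw [← labelFun_empty hf]
      exact labelFun_mono hf (Finset.empty_subset _)
    have e : S ∪ insert l T = S ∪ T ∪ {l} := by ext; simp
    rw [Finset.card_insert_of_notMem hl, e]
    push_cast
    linarith

theorem labelFun_le_card (hf : IsShannon f) (hn : IsNormalized f) (S : Finset VamosLabel) :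
    labelFun f S ≤ S.card := by
  have := labelFun_union_le hf hn ∅ S
  rwa [Finset.empty_union, labelFun_empty hf, zero_add] at this

open VamosLabel in
theorem apply_univ_le_seven (hf : IsShannon f) (hn : IsNormalized f)
    (hc : SatisfiesConstraints vamosGraph f) : f Set.univ ≤ 7 := by
  rw [← labelFun_univ hf hc, labelFun_congr hf hc (T := {a1, a2, b, c1, c2, d1, d2}) (by decide)]
  exact labelFun_le_card hf hn _

open VamosLabel in
/-- A message that, together with two others and `a, b, c, d`, determines everything is nearly
independent of the elements of the Vámos matroid. -/
theorem labelFun_insert_ge (hf : IsShannon f) (hn : IsNormalized f)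
    (hc : SatisfiesConstraints vamosGraph f) {m : VamosLabel} (m' m'' : VamosLabel)
    (hm : closure {a, b, c, d, m, m', m''} = Finset.univ)
    (hm' : m ∉ ({a, b, c, d, w, x, y, z} : Finset VamosLabel))
    {S : Finset VamosLabel} (hS : S ⊆ {a, b, c, d, w, x, y, z}) :
    labelFun f S + (f Set.univ - 6) ≤ labelFun f (insert m S) := by
  have h1 : labelFun f {a, b, c, d, m, m', m''} = f Set.univ := by
    rw [← labelFun_univ hf hc]
    exact labelFun_congr hf hc (by rw [hm]; decide)
  have h2 := labelFun_union_le hf hn (insert m {a, b, c, d, w, x, y, z}) {m', m''}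
  have h3 : labelFun f {a, b, c, d, m, m', m''} ≤
      labelFun f (insert m {a, b, c, d, w, x, y, z} ∪ {m', m''}) :=
    labelFun_mono hf fun l hl => by
      simp only [Finset.mem_union, Finset.mem_insert, Finset.mem_singleton] at hl ⊢
      tauto
  have h4 : labelFun f {a, b, c, d, w, x, y, z} = labelFun f {a, b, c, d} :=
    labelFun_congr hf hc (by decide)
  have h5 := labelFun_le_card hf hn {a, b, c, d}
  -- Diminishing returns: `m` adds at least as much to `S` as to all eight Vámos labels. There it
  -- adds at least `f(V) - 2 - 4`, since `m'` and `m''` add at most `2` and the eight labels carry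
  -- at most `4`.
  have h6 := labelFun_union_add_inter_le hf (insert m S) {a, b, c, d, w, x, y, z}
  have e1 : insert m S ∪ {a, b, c, d, w, x, y, z} = insert m {a, b, c, d, w, x, y, z} := by
    rw [Finset.insert_union, Finset.union_eq_right.2 hS]
  have e2 : insert m S ∩ {a, b, c, d, w, x, y, z} = S := by
    rw [Finset.insert_inter_of_notMem hm', Finset.inter_eq_left.2 hS]
  rw [e1, e2] at h6
  have h7 : ((({m', m''} : Finset VamosLabel).card : ℕ) : ℝ) ≤ 2 := by
    exact_mod_cast Finset.card_le_two
  have h8 : ((({a, b, c, d} : Finset VamosLabel).card : ℕ) : ℝ) = 4 := by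
    have : ({a, b, c, d} : Finset VamosLabel).card = 4 := by decide
    exact_mod_cast this
  linarith

open VamosLabel in
/-- If an element of the Vámos matroid is determined by others and one message, then it is nearly
determined by those others. -/
theorem labelFun_insert_le (hf : IsShannon f) (hn : IsNormalized f)
    (hc : SatisfiesConstraints vamosGraph f) (v m m' m'' : VamosLabel) (S : Finset VamosLabel)
    (hm : closure {a, b, c, d, m, m', m''} = Finset.univ ∧
      m ∉ ({a, b, c, d, w, x, y, z} : Finset VamosLabel) ∧
      insert v S ⊆ {a, b, c, d, w, x, y, z} ∧
      closure (insert m (insert v S)) = closure (insert m S)) :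
    labelFun f (insert v S) ≤ labelFun f S + (7 - f Set.univ) := by
  obtain ⟨h1, h2, h3, h4⟩ := hm
  have h5 := labelFun_insert_ge hf hn hc m' m'' h1 h2 h3
  rw [labelFun_congr hf hc h4] at h5
  have h6 := labelFun_union_le hf hn S {m}
  rw [Finset.union_comm, Finset.card_singleton, Nat.cast_one, ← Finset.insert_eq] at h6
  linarith

open VamosLabel in
/-- The bound on the Zhang-Yeung entropy of the Vámos graph. -/
theorem apply_univ_le_of_isZhangYeung (hf : IsZhangYeung f) (hn : IsNormalized f)
    (hc : SatisfiesConstraints vamosGraph f) : f Set.univ ≤ 7 - 1 / 34 := by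
  have hs := hf.isShannon
  set g := labelFun f with hg
  have sub := labelFun_union_add_inter_le hs
  have card : ∀ (S : Finset VamosLabel) (n : ℕ), S.card = n → g S ≤ n := fun S n h =>
    h ▸ labelFun_le_card hs hn S
  have congr : ∀ {S T : Finset VamosLabel}, closure S = closure T → g S = g T :=
    fun h => labelFun_congr hs hc h
  have near := labelFun_insert_le hs hn hc
  have zy : ∀ A B C D : Finset VamosLabel,
      2 * (g C + g D - g (C ∪ D)) ≤ (g A + g B - g (A ∪ B))
        + (g A + g (C ∪ D) - g (A ∪ (C ∪ D)))
        + 3 * (g (C ∪ A) + g (D ∪ A) - g (C ∪ D ∪ A) - g A)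
        + (g (C ∪ B) + g (D ∪ B) - g (C ∪ D ∪ B) - g B) := by
    intro A B C D
    have := (hf.comp_image VamosLabel.rep).zhangYeung A B C D
    simp only [mutualInfo, Set.union_empty, ← Finset.coe_union] at this
    have h0 : f (VamosLabel.rep '' ∅) = 0 := by simpa using hf.empty
    rw [h0] at this
    simp only [hg, labelFun]
    linarith
  have add : ∀ S T : Finset VamosLabel, g (S ∪ T) ≤ g S + T.card := labelFun_union_le hs hn
  have mono : ∀ {S T : Finset VamosLabel}, S ⊆ T → g S ≤ g T := labelFun_mono hs
  -- Six receivers, each with its auxiliary message as the second argument: for instance `b, x, y,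
  -- c1` give `c2`, hence `c`. Each dependency of the matroid element on the remaining labels holds
  -- up to `ε = 7 - f(V)`.
  have near_c := near c c1 a1 d1 {b, x, y} (by decide)
  have near_d := near d d1 a1 c1 {b, x, z} (by decide)
  have near_a := near a a2 c1 d1 {b, w, x} (by decide)
  have near_d' := near d d2 a1 c1 {a, b, c, w} (by decide)
  have near_c' := near c c2 a1 d1 {a, b, d, w} (by decide)
  have near_a' := near a a1 c1 d1 {c, d, y, z} (by decide)
  rw [← hg] at near_c near_d near_a near_d' near_c' near_a'
  have abcd : f Set.univ ≤ g {a, b, c, d} + 3 := by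
    rw [← labelFun_univ hs hc]
    exact (congr (T := {a, b, c, d} ∪ {a1, c1, d1}) (by decide)).trans_le (add _ _)
  have abcdw : g {d, a, b, c, w} = g {a, b, c, d} := congr (by decide)
  have abdcw : g {c, a, b, d, w} = g {a, b, c, d} := congr (by decide)
  have acdyz : g {a, c, d, y, z} = g {a, b, c, d} := congr (by decide)
  have abwx : g {a, b, w, x} = g {a, b, w} := congr (by decide)
  -- Lower bounds for small sets come from large ones, whose value is at least `4 - 2ε`, by deleting
  -- labels at a cost of at most one each. The pairs `aw`, `cy`, `dz` thus keep at least `2 - 2ε`,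
  -- and `bx` at least `2 - 3ε`.
  have abw : g {a, b, c, w} ≤ g {a, b, w} + 1 := by
    simpa using (mono (by decide)).trans (add {a, b, w} {c})
  have bx : g {b, w, x} ≤ g {b, x} + 1 := by
    simpa using (mono (by decide)).trans (add {b, x} {w})
  have aw : g {a, b, c, w} ≤ g {a, w} + 2 := by
    simpa using (mono (by decide)).trans (add {a, w} {b, c})
  have cy : g {c, d, y, z} ≤ g {c, y} + 2 := by
    simpa using (mono (by decide)).trans (add {c, y} {d, z})
  have dz : g {c, d, y, z} ≤ g {d, z} + 2 := by
    simpa using (mono (by decide)).trans (add {d, z} {c, y})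
  have cy_le : g {c, y} ≤ 2 := by exact_mod_cast card _ 2 (by decide)
  have dz_le : g {d, z} ≤ 2 := by exact_mod_cast card _ 2 (by decide)
  have abw_le : g {a, b, w} ≤ 3 := by exact_mod_cast card _ 3 (by decide)
  have acw_le : g {a, c, w} ≤ 3 := by exact_mod_cast card _ 3 (by decide)
  have adw_le : g {a, d, w} ≤ 3 := by exact_mod_cast card _ 3 (by decide)
  have bxy_le : g {b, x, y} ≤ 3 := by exact_mod_cast card _ 3 (by decide)
  have bxz_le : g {b, x, z} ≤ 3 := by exact_mod_cast card _ 3 (by decide)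
  -- `{c,y}` and `{d,z}` are the two pairs whose union is not a circuit, so their mutual information
  -- vanishes in the matroid; `{a,w}` and `{b,x}` share one unit, and each forms a circuit with
  -- either of the other two.
  have h := zy {c, y} {d, z} {a, w} {b, x}
  have e1 : g ({a, w} ∪ {b, x}) = g {a, b, w} := congr (by decide)
  have e2 : g ({c, y} ∪ {d, z}) = g {c, d, y, z} := congr (by decide)
  have e3 : g ({a, w} ∪ {c, y}) = g {a, c, w} := congr (by decide)
  have e4 : g ({a, w} ∪ {d, z}) = g {a, d, w} := congr (by decide)
  have e5 : g ({b, x} ∪ {c, y}) = g {c, b, x, y} := congr (by decide)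
  have e6 : g ({b, x} ∪ {d, z}) = g {d, b, x, z} := congr (by decide)
  have l1 : g {a, b, c, w} ≤ g ({c, y} ∪ ({a, w} ∪ {b, x})) := mono (by decide)
  have l2 : g {a, b, c, w} ≤ g ({a, w} ∪ {b, x} ∪ {c, y}) := mono (by decide)
  have l3 : g {a, b, d, w} ≤ g ({a, w} ∪ {b, x} ∪ {d, z}) := mono (by decide)
  rw [e1, e2, e3, e4, e5, e6] at h
  -- With all negative terms moved across, one side is at least `34 - 24ε` and the other at most `33
  -- + 4ε`. This gives `ε ≥ 1/28`, more than the stated `1/34`.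
  linarith

end LabelFunction

/-! ### Functions on vertex sets induced by labels -/

section Pullback

variable {V L : Type*} [Fintype L]

open Classical in
/-- The function on subsets of `V` that is induced by a function on sets of labels. -/
noncomputable def pullback (F : Finset L → ℕ) (label : V → L) (S : Set V) : ℝ :=
  F (Finset.univ.filter fun l => l ∈ label '' S)

theorem pullback_univ (F : Finset L → ℕ) {label : V → L} (h : Function.Surjective label) :
    pullback F label Set.univ = F Finset.univ := by
  unfold pullback
  congr 2
  ext l
  simp [h.range_eq]

end Pullback

/-! ### The rank function of the extended Vámos matroid -/

section RankFunction

variable {L : Type*} [DecidableEq L]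

/-- Monotone submodular functions on finite sets with values in the natural numbers. -/
structure IsPolymatroid (F : Finset L → ℕ) : Prop where
  mono : ∀ {X Y : Finset L}, X ⊆ Y → F X ≤ F Y
  submodular : ∀ X Y, F (X ∪ Y) + F (X ∩ Y) ≤ F X + F Y

/-- The parallel connection of `F` at `a` with the line `{a, a₁, a₂}`. -/
def addLine (F : Finset L → ℕ) (a a₁ a₂ : L) (X : Finset L) : ℕ :=
  F (if a₁ ∈ X ∧ a₂ ∈ X then insert a X else X) + if a₁ ∈ X ∨ a₂ ∈ X then 1 else 0

theorem IsPolymatroid.insert_le {F : Finset L → ℕ} (hF : IsPolymatroid F) {a : L}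
    (ha : F {a} ≤ 1) (X : Finset L) : F (insert a X) ≤ F X + 1 := by
  have := hF.submodular {a} X
  rw [← Finset.insert_eq] at this
  omega

/-- The delicate case has `a₁` only in `X` and `a₂` only in `Y`: the union acquires `a`, which costs
at most `F {a} ≤ 1`, and this is paid for by the extra unit counted once for `X` and once for `Y`.
-/
theorem IsPolymatroid.addLine {F : Finset L → ℕ} (hF : IsPolymatroid F) {a : L} (a₁ a₂ : L)
    (ha : F {a} ≤ 1) : IsPolymatroid (addLine F a a₁ a₂) where
  mono {X Y} h := by
    unfold GraphEntropy.addLine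
    refine Nat.add_le_add (hF.mono ?_) ?_
    · by_cases h1 : a₁ ∈ X ∧ a₂ ∈ X
      · rw [if_pos h1, if_pos ⟨h h1.1, h h1.2⟩]
        exact Finset.insert_subset_insert a h
      · rw [if_neg h1]
        split_ifs
        · exact h.trans (Finset.subset_insert a Y)
        · exact h
    · by_cases h1 : a₁ ∈ X ∨ a₂ ∈ X
      · rw [if_pos h1, if_pos (h1.imp (@h _) (@h _))]
      · rw [if_neg h1]
        exact Nat.zero_le _
  submodular X Y := by
    have s1 := hF.submodular X Y
    have s2 := hF.submodular (insert a X) Y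
    have s3 := hF.submodular X (insert a Y)
    have s4 := hF.submodular (insert a X) (insert a Y)
    have m1 : F (X ∩ Y) ≤ F (insert a X ∩ Y) :=
      hF.mono (Finset.inter_subset_inter_right (Finset.subset_insert a X))
    have m2 : F (X ∩ Y) ≤ F (X ∩ insert a Y) :=
      hF.mono (Finset.inter_subset_inter_left (Finset.subset_insert a Y))
    have u := hF.insert_le ha (X ∪ Y)
    rw [← Finset.insert_inter_distrib, Finset.insert_union, Finset.union_insert,
      Finset.insert_idem] at s4
    rw [Finset.insert_union] at s2
    rw [Finset.union_insert] at s3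
    unfold GraphEntropy.addLine
    by_cases h1 : a₁ ∈ X <;> by_cases h2 : a₂ ∈ X <;> by_cases h3 : a₁ ∈ Y <;>
      by_cases h4 : a₂ ∈ Y <;> simp [h1, h2, h3, h4] <;> omega

/-- The rank function of a sparse paving matroid of rank `4`. -/
def pavingRank (C : List (Finset L)) (X : Finset L) : ℕ := if X ∈ C then 3 else min X.card 4

/-- For incomparable `X` and `Y` the intersection is strictly smaller than both, which absorbs the
loss of one when a single set lies in `C`. If both do, the bound on intersections gives `4 + 2 ≤ 3 +
3`. -/
theorem isPolymatroid_pavingRank {C : List (Finset L)} (hC : ∀ X ∈ C, X.card = 4)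
    (hCC : ∀ X ∈ C, ∀ Y ∈ C, X ≠ Y → (X ∩ Y).card ≤ 2) : IsPolymatroid (pavingRank C) := by
  have hle : ∀ X, pavingRank C X ≤ min X.card 4 := by
    intro X
    unfold pavingRank
    split_ifs with h
    · rw [hC X h]; decide
    · exact le_rfl
  have mono : ∀ {X Y : Finset L}, X ⊆ Y → pavingRank C X ≤ pavingRank C Y := by
    intro X Y h
    rcases h.eq_or_ssubset with rfl | h'
    · exact le_rfl
    · have h1 := Finset.card_lt_card h'
      have h2 := hle X
      unfold pavingRank at h2 ⊢
      by_cases hX : X ∈ C <;> by_cases hY : Y ∈ C <;>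
        simp only [hX, hY, if_true, if_false] at h2 ⊢
      · omega
      · have := hC X hX
        omega
      · have := hC Y hY
        omega
      · omega
  refine ⟨mono, fun X Y => ?_⟩
  by_cases hXY : X ⊆ Y
  · rw [Finset.union_eq_right.2 hXY, Finset.inter_eq_left.2 hXY, add_comm]
  by_cases hYX : Y ⊆ X
  · rw [Finset.union_eq_left.2 hYX, Finset.inter_eq_right.2 hYX]
  have h1 : (X ∩ Y).card < X.card := Finset.card_lt_card
    ⟨Finset.inter_subset_left, fun h => hXY fun l hl => (Finset.mem_inter.1 (h hl)).2⟩
  have h2 : (X ∩ Y).card < Y.card := Finset.card_lt_card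
    ⟨Finset.inter_subset_right, fun h => hYX fun l hl => (Finset.mem_inter.1 (h hl)).1⟩
  have h3 := Finset.card_union_add_card_inter X Y
  have h4 := hle (X ∪ Y)
  have h5 := hle (X ∩ Y)
  by_cases hX : X ∈ C <;> by_cases hY : Y ∈ C
  · have := hCC X hX Y hY (fun h => hXY h.le)
    have e1 : pavingRank C X = 3 := if_pos hX
    have e2 : pavingRank C Y = 3 := if_pos hY
    omega
  · have := hC X hX
    have e1 : pavingRank C X = 3 := if_pos hX
    have e2 : pavingRank C Y = min Y.card 4 := if_neg hY
    omega
  · have := hC Y hY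
    have e1 : pavingRank C X = min X.card 4 := if_neg hX
    have e2 : pavingRank C Y = 3 := if_pos hY
    omega
  · have e1 : pavingRank C X = min X.card 4 := if_neg hX
    have e2 : pavingRank C Y = min Y.card 4 := if_neg hY
    omega

theorem IsPolymatroid.inter {F : Finset L → ℕ} (hF : IsPolymatroid F) (E : Finset L) :
    IsPolymatroid fun X => F (X ∩ E) where
  mono h := hF.mono (Finset.inter_subset_inter_right h)
  submodular X Y := by
    have := hF.submodular (X ∩ E) (Y ∩ E)
    rwa [← Finset.union_inter_distrib_right, ← Finset.inter_inter_distrib_right] at this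

section PullbackRank

variable {V : Type*} [Fintype L]

theorem IsPolymatroid.isShannon_pullback {F : Finset L → ℕ} (hF : IsPolymatroid F) (h0 : F ∅ = 0)
    (label : V → L) : IsShannon (pullback F label) where
  empty := by simp [pullback, h0]
  shannon X Y Z := by
    classical
    have hs := hF.submodular
      (Finset.univ.filter fun l => l ∈ label '' (X ∪ Z))
      (Finset.univ.filter fun l => l ∈ label '' (Y ∪ Z))
    have e : (Finset.univ.filter fun l => l ∈ label '' (X ∪ Z)) ∪
        (Finset.univ.filter fun l => l ∈ label '' (Y ∪ Z)) =
        Finset.univ.filter fun l => l ∈ label '' (X ∪ Y ∪ Z) := by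
      ext l
      simp only [Set.image_union, Finset.mem_union, Finset.mem_filter, Finset.mem_univ, true_and,
        Set.mem_union]
      tauto
    have hm : F (Finset.univ.filter fun l => l ∈ label '' Z) ≤
        F ((Finset.univ.filter fun l => l ∈ label '' (X ∪ Z)) ∩
          (Finset.univ.filter fun l => l ∈ label '' (Y ∪ Z))) := by
      refine hF.mono fun l hl => ?_
      simp only [Set.image_union, Finset.mem_inter, Finset.mem_filter, Finset.mem_univ, true_and,
        Set.mem_union] at hl ⊢
      exact ⟨.inr hl, .inr hl⟩
    rw [e] at hs
    have := (Nat.add_le_add_left hm _).trans hs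
    unfold pullback
    rw [add_comm]
    exact_mod_cast this

theorem pullback_singleton (F : Finset L → ℕ) (label : V → L) (v : V) :
    pullback F label {v} = F {label v} := by
  unfold pullback
  congr 2
  ext l
  simp

/-- A vertex is determined by `P` if the labels on `P` include its own label, or include a set
that spans its label. -/
theorem IsPolymatroid.cond_pullback_eq_zero {F : Finset L → ℕ} (hF : IsPolymatroid F)
    {label : V → L} {v : V} {P : Set V} {Q : Finset L} (hQ : F (insert (label v) Q) = F Q)
    (h : label v ∈ label '' P ∨ ↑Q ⊆ label '' P) : cond (pullback F label) {v} P = 0 := by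
  classical
  set T := Finset.univ.filter fun l => l ∈ label '' P with hT
  have e : (Finset.univ.filter fun l => l ∈ label '' ({v} ∪ P)) = insert (label v) T := by
    ext l
    simp only [hT, Set.image_union, Set.image_singleton, Finset.mem_filter, Finset.mem_univ,
      true_and, Set.mem_union, Set.mem_singleton_iff, Finset.mem_insert]
  have key : F (insert (label v) T) = F T := by
    rcases h with h | h
    · rw [Finset.insert_eq_of_mem (by simpa [hT] using h)]
    · have hsub : Q ⊆ T := fun l hl => by simpa [hT] using h hl
      refine le_antisymm ?_ (hF.mono (Finset.subset_insert _ _))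
      -- Spanning passes from `Q` to the larger set `T`, again by diminishing returns.
      have h1 := hF.submodular (insert (label v) Q) T
      rw [hQ, Finset.insert_union, Finset.union_eq_right.2 hsub] at h1
      have h2 : F Q ≤ F (insert (label v) Q ∩ T) :=
        hF.mono (Finset.subset_inter (Finset.subset_insert _ _) hsub)
      omega
  rw [cond, sub_eq_zero, pullback, pullback, Nat.cast_inj, ← hT, ← key, ← e]

end PullbackRank

namespace VamosLabel

/-- The circuits of size `4` of the Vámos matroid. -/
def circuits : List (Finset VamosLabel) :=
  [{a, w, b, x}, {a, w, c, y}, {a, w, d, z}, {b, x, c, y}, {b, x, d, z}]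

/-- The rank of a set of labels: the Vámos matroid, with the lines `{m, m₁, m₂}` attached for
`m = a, c, d`. -/
def rank : Finset VamosLabel → ℕ :=
  addLine (addLine (addLine (fun X => pavingRank circuits (X ∩ {a, b, c, d, w, x, y, z}))
    a a1 a2) c c1 c2) d d1 d2

theorem card_of_mem_circuits (X) (hX : X ∈ circuits) : X.card = 4 :=
  of_decide_eq_true (List.all_eq_true.1
    (by decide : circuits.all (fun X => decide (X.card = 4)) = true) X hX)

theorem card_inter_of_mem_circuits (X) (hX : X ∈ circuits) (Y) (hY : Y ∈ circuits) (h : X ≠ Y) :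
    (X ∩ Y).card ≤ 2 :=
  of_decide_eq_true (List.all_eq_true.1 (List.all_eq_true.1
    (by decide : circuits.all (fun X => circuits.all fun Y =>
      decide (X ≠ Y → (X ∩ Y).card ≤ 2)) = true) X hX) Y hY) h

theorem isPolymatroid_rank : IsPolymatroid rank := by
  have h0 := (isPolymatroid_pavingRank card_of_mem_circuits card_inter_of_mem_circuits).inter
    {a, b, c, d, w, x, y, z}
  have h1 := h0.addLine (a := a) a1 a2 (by decide)
  have h2 := h1.addLine (a := c) c1 c2 (by decide)
  exact h2.addLine (a := d) d1 d2 (by decide)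

theorem rank_singleton_le : ∀ l, rank {l} ≤ 1 := by decide

theorem rank_insert_deps : ∀ l, rank (insert l l.deps) = rank l.deps := by decide

theorem rank_univ : rank Finset.univ = 7 := by decide

end VamosLabel

end RankFunction

/-! ### The three entropies of the Vámos graph -/

theorem seven_le_shannonEntropy : 7 ≤ shannonEntropy vamosGraph := by
  refine le_csSup ⟨7, ?_⟩ ⟨pullback VamosLabel.rank vamosLabel,
    VamosLabel.isPolymatroid_rank.isShannon_pullback (by decide) _, fun j => ?_, fun j => ?_, ?_⟩
  -- Boundedness above is needed, since the real supremum of an unbounded set is `0`.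
  · rintro _ ⟨f, hf, hn, hc, rfl⟩
    exact apply_univ_le_seven hf hn hc
  · rw [pullback_singleton]
    exact_mod_cast VamosLabel.rank_singleton_le _
  · exact VamosLabel.isPolymatroid_rank.cond_pullback_eq_zero (VamosLabel.rank_insert_deps _)
      (preds_cases j).2
  · rw [pullback_univ _ fun l => ⟨l.rep, vamosLabel_rep l⟩, VamosLabel.rank_univ]
    norm_num

theorem zhangYeungEntropy_le : zhangYeungEntropy vamosGraph ≤ 7 - 1 / 34 := by
  refine Real.sSup_le ?_ (by norm_num)
  rintro _ ⟨f, hf, hn, hc, rfl⟩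
  exact apply_univ_le_of_isZhangYeung hf hn hc

theorem generalEntropy_le : generalEntropy vamosGraph ≤ 7 - 1 / 34 := by
  -- The bound must be nonnegative, since the real supremum of an empty set is `0`.
  refine Real.sSup_le ?_ (by norm_num)
  rintro _ ⟨s, hs, rfl⟩
  refine Real.sSup_le ?_ (by norm_num)
  rintro _ ⟨p, hp, hp1, hc, rfl⟩
  exact apply_univ_le_of_isZhangYeung (isZhangYeung_entropyFun hp hp1)
    (isNormalized_entropyFun hp hp1 hs) hc

end GraphEntropy

theorem theorem11 :
    GraphEntropy.zhangYeungEntropy GraphEntropy.vamosGraph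
        < GraphEntropy.shannonEntropy GraphEntropy.vamosGraph ∧
      GraphEntropy.generalEntropy GraphEntropy.vamosGraph
        < GraphEntropy.shannonEntropy GraphEntropy.vamosGraph :=
  ⟨(GraphEntropy.zhangYeungEntropy_le.trans_lt (by norm_num)).trans_le
      GraphEntropy.seven_le_shannonEntropy,
    (GraphEntropy.generalEntropy_le.trans_lt (by norm_num)).trans_le
      GraphEntropy.seven_le_shannonEntropy⟩
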